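/- Let $a>0$, let $O^+=\{(x,y,z)\in\mathbb R^3: x>0,\ y>0,\ z>0\}$, and define on $O^+$ $$V_1(x,y,z)=\frac{(x+1)(y+1)(z+1)(a+x+y+z)}{xyz},\qquad V_2(x,y,z)=\frac{(1+y+z)(1+x+y)(a+x+y+z+xz)}{xyz}.$$ Put $x_c=1+\sqrt{1+a}$, $k_c=V_1(x_c,x_c,x_c)$ and $h_c=V_2(x_c,x_c,x_c)$. Then: (a) for every $k>k_c$ the level set $L_k=\{(x,y,z)\in O^+: V_1(x,y,z)=k\}$ is diffeomorphic to the sphere $\mathbb S^2$; (b) for every $h>h_c$ the level set $M_h=\{(x,y,z)\in O^+: V_2(x,y,z)=h\}$ is diffeomorphic to the sphere $\mathbb S^2$. Here two subsets of Euclidean spaces are diffeomorphic if there is a bijection between them such that it and its inverse are smooth, i.e. near each point of their domain they are restrictions of $C^\infty$ maps defined on open sets of the ambient space. (In particular $L_k$ and $M_h$ are smooth embedded surfaces in $\mathbb R^3$.) -/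

import Mathlib

open scoped ContDiff

noncomputable section

namespace Lyness

/-- Smoothness of a map on an arbitrary subset `X` of a Euclidean space: near every point of `X`
the map agrees on `X` with a `C^∞` map that is defined on an open set of the ambient space. -/
def SmoothOnSubset {m n : ℕ} (f : EuclideanSpace ℝ (Fin m) → EuclideanSpace ℝ (Fin n))
    (X : Set (EuclideanSpace ℝ (Fin m))) : Prop :=
  ∀ p ∈ X, ∃ U : Set (EuclideanSpace ℝ (Fin m)), IsOpen U ∧ p ∈ U ∧
    ∃ g : EuclideanSpace ℝ (Fin m) → EuclideanSpace ℝ (Fin n),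
      ContDiffOn ℝ ∞ g U ∧ Set.EqOn g f (U ∩ X)

/-- Two subsets of Euclidean spaces are diffeomorphic: there are mutually inverse bijections
between them that are smooth in both directions. If `Y` is a smooth embedded submanifold, this
says exactly that `X` is a smooth embedded submanifold which is diffeomorphic to `Y`. -/
def AreDiffeomorphic {m n : ℕ} (X : Set (EuclideanSpace ℝ (Fin m)))
    (Y : Set (EuclideanSpace ℝ (Fin n))) : Prop :=
  ∃ (f : EuclideanSpace ℝ (Fin m) → EuclideanSpace ℝ (Fin n))
    (g : EuclideanSpace ℝ (Fin n) → EuclideanSpace ℝ (Fin m)),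
    Set.MapsTo f X Y ∧ Set.MapsTo g Y X ∧ Set.InvOn g f X Y ∧
      SmoothOnSubset f X ∧ SmoothOnSubset g Y

/-- The open positive octant `O⁺` of `ℝ³`. -/
def octant : Set (EuclideanSpace ℝ (Fin 3)) :=
  {p | 0 < p 0 ∧ 0 < p 1 ∧ 0 < p 2}

/-- The first integral `V₁`; it is only used on the positive octant. -/
def V₁ (a : ℝ) (p : EuclideanSpace ℝ (Fin 3)) : ℝ :=
  (p 0 + 1) * (p 1 + 1) * (p 2 + 1) * (a + p 0 + p 1 + p 2) / (p 0 * p 1 * p 2)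

/-- The first integral `V₂`; it is only used on the positive octant. -/
def V₂ (a : ℝ) (p : EuclideanSpace ℝ (Fin 3)) : ℝ :=
  (1 + p 1 + p 2) * (1 + p 0 + p 1) * (a + p 0 + p 1 + p 2 + p 0 * p 2) / (p 0 * p 1 * p 2)

/-- The coordinate `x_c = 1 + √(1 + a)` of the fixed point. -/
def xc (a : ℝ) : ℝ := 1 + √(1 + a)

/-- The fixed point `(x_c, x_c, x_c)` of the Lyness map. -/
def fixedPoint (a : ℝ) : EuclideanSpace ℝ (Fin 3) := !₂[xc a, xc a, xc a]

/-- The critical value `k_c` of `V₁`. -/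
def kc (a : ℝ) : ℝ := V₁ a (fixedPoint a)

/-- The critical value `h_c` of `V₂`. -/
def hc (a : ℝ) : ℝ := V₂ a (fixedPoint a)

/-- The level surface `L_k` of `V₁` in the positive octant. -/
def L (a k : ℝ) : Set (EuclideanSpace ℝ (Fin 3)) := {p | p ∈ octant ∧ V₁ a p = k}

/-- The level surface `M_h` of `V₂` in the positive octant. -/
def M (a h : ℝ) : Set (EuclideanSpace ℝ (Fin 3)) := {p | p ∈ octant ∧ V₂ a p = h}

/-- The unit sphere `S²` in Euclidean `ℝ³`. -/
def unitSphere : Set (EuclideanSpace ℝ (Fin 3)) := Metric.sphere 0 1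

end Lyness

end

/-!
In the logarithmic coordinates `x = exp u`, `y = exp v`, `z = exp w` the octant becomes `ℝ³` and
both `V₁` and `V₂` become posynomials: finite sums of terms `b * exp (ℓ u)` with `b ≥ 0` and `ℓ`
linear. Such a function is smooth and convex. Moreover `x`, `y`, `z`, `a / x`, `a / y`, `a / z` are
all bounded by `V₁` and by `V₂`, so the posynomial is coercive.

Let `F` be a smooth convex function on a Euclidean space with `F c < k` that exceeds `k` somewhere
on every ray issuing from `c`. Every such ray then meets `{F = k}` in exactly one point, and by
convexity the radial derivative of `F` is positive there. Hence the radial projection from `c` maps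
`{F = k}` bijectively onto the unit sphere, and by the implicit function theorem its inverse is
smooth (`areDiffeomorphic_levelSet_sphere`). This is applied with `c` the fixed point in logarithmic
coordinates. It is not needed that `c` is the minimizer, only that the value at `c` is below the
level.
-/

open scoped Topology

namespace Lyness

/-! ### Smooth maps between subsets of Euclidean spaces -/

section Smooth

variable {l m n : ℕ}

theorem SmoothOnSubset.of_contDiffOn {f : EuclideanSpace ℝ (Fin m) → EuclideanSpace ℝ (Fin n)}
    {X U : Set (EuclideanSpace ℝ (Fin m))} (hU : IsOpen U) (hXU : X ⊆ U)
    (hf : ContDiffOn ℝ ∞ f U) : SmoothOnSubset f X :=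
  fun _ hp => ⟨U, hU, hXU hp, f, hf, fun _ _ => rfl⟩

theorem SmoothOnSubset.comp {f : EuclideanSpace ℝ (Fin l) → EuclideanSpace ℝ (Fin m)}
    {g : EuclideanSpace ℝ (Fin m) → EuclideanSpace ℝ (Fin n)}
    {X : Set (EuclideanSpace ℝ (Fin l))} {Y : Set (EuclideanSpace ℝ (Fin m))}
    (hg : SmoothOnSubset g Y) (hf : SmoothOnSubset f X) (hXY : Set.MapsTo f X Y) :
    SmoothOnSubset (g ∘ f) X := by
  intro p hp
  obtain ⟨U, hU, hpU, f', hf', hff'⟩ := hf p hp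
  obtain ⟨W, hW, hpW, g', hg', hgg'⟩ := hg (f p) (hXY hp)
  refine ⟨U ∩ f' ⁻¹' W, hf'.continuousOn.isOpen_inter_preimage hU hW,
    ⟨hpU, ?_⟩, g' ∘ f', ?_, ?_⟩
  · rw [Set.mem_preimage, hff' ⟨hpU, hp⟩]
    exact hpW
  · exact hg'.comp (hf'.mono Set.inter_subset_left) fun q hq => hq.2
  · rintro q ⟨⟨hqU, hqW⟩, hqX⟩
    have hq := hff' ⟨hqU, hqX⟩
    rw [Set.mem_preimage, hq] at hqW
    simpa [hq] using hgg' ⟨hqW, hXY hqX⟩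

theorem AreDiffeomorphic.trans {X : Set (EuclideanSpace ℝ (Fin l))}
    {Y : Set (EuclideanSpace ℝ (Fin m))} {Z : Set (EuclideanSpace ℝ (Fin n))}
    (hXY : AreDiffeomorphic X Y) (hYZ : AreDiffeomorphic Y Z) : AreDiffeomorphic X Z := by
  obtain ⟨f, g, hf, hg, hfg, hfs, hgs⟩ := hXY
  obtain ⟨f', g', hf', hg', hfg', hfs', hgs'⟩ := hYZ
  exact ⟨f' ∘ f, g ∘ g', hf'.comp hf, hg.comp hg', hfg.comp hfg' hf hg',
    hfs'.comp hfs hf, hgs.comp hgs' hg'⟩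

end Smooth

/-! ### Level sets of convex functions -/

section Convex

variable {E : Type*} [NormedAddCommGroup E] [NormedSpace ℝ E] {F : E → ℝ} {c θ : E} {k : ℝ}

theorem convexOn_ray (hF : ConvexOn ℝ Set.univ F) (c θ : E) :
    ConvexOn ℝ Set.univ fun t : ℝ => F (c + t • θ) := by
  have h := hF.comp_affineMap (AffineMap.lineMap c (c + θ))
  have he : F ∘ (AffineMap.lineMap c (c + θ) : ℝ →ᵃ[ℝ] E) = fun t : ℝ => F (c + t • θ) := by
    funext t
    simp [AffineMap.lineMap_apply, add_comm]
  rwa [he, Set.preimage_univ] at h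

theorem lt_level_of_mem_ray (hF : ConvexOn ℝ Set.univ F) (hc : F c < k) {s t : ℝ}
    (hs : 0 < s) (hst : s < t) (ht : F (c + t • θ) = k) : F (c + s • θ) < k := by
  have ht0 : 0 < t := hs.trans hst
  have h := (convexOn_ray hF c θ).2 (Set.mem_univ 0) (Set.mem_univ t)
    (sub_nonneg.2 ((div_le_one ht0).2 hst.le)) (div_nonneg hs.le ht0.le) (sub_add_cancel 1 (s / t))
  have hcomb : (1 - s / t) * 0 + s / t * t = s := by
    rw [mul_zero, zero_add, div_mul_cancel₀ _ ht0.ne']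
  simp only [smul_eq_mul, hcomb, zero_smul, add_zero, ht] at h
  have hlt : 0 < 1 - s / t := sub_pos.2 ((div_lt_one ht0).2 hst)
  nlinarith [mul_lt_mul_of_pos_left hc hlt]

theorem level_on_ray_unique (hF : ConvexOn ℝ Set.univ F) (hc : F c < k) {s t : ℝ}
    (hs : 0 < s) (ht : 0 < t) (hFs : F (c + s • θ) = k) (hFt : F (c + t • θ) = k) : s = t := by
  rcases lt_trichotomy s t with h | h | h
  · exact absurd hFs (lt_level_of_mem_ray hF hc hs h hFt).ne
  · exact h
  · exact absurd hFt (lt_level_of_mem_ray hF hc ht h hFs).ne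

theorem exists_level_on_ray (hF : Continuous F) (hc : F c < k)
    (hθ : ∃ t : ℝ, 0 < t ∧ k < F (c + t • θ)) :
    ∃ t : ℝ, 0 < t ∧ F (c + t • θ) = k := by
  obtain ⟨t, ht, hkt⟩ := hθ
  have hcont : Continuous fun s : ℝ => F (c + s • θ) := by fun_prop
  obtain ⟨s, hs, hsk⟩ := intermediate_value_Icc ht.le hcont.continuousOn
    ⟨by simpa using hc.le, hkt.le⟩
  refine ⟨s, hs.1.lt_of_ne ?_, hsk⟩
  rintro rfl
  simp only [zero_smul, add_zero] at hsk
  exact hc.ne hsk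

/-- A convex function increases strictly along the ray from `c` where that ray leaves the sublevel
set; this is the transversality that the implicit function theorem needs. -/
theorem radial_deriv_pos (hF : ConvexOn ℝ Set.univ F) (hc : F c < k) {t : ℝ} (ht : 0 < t)
    (hd : DifferentiableAt ℝ F (c + t • θ)) (hFt : F (c + t • θ) = k) :
    0 < fderiv ℝ F (c + t • θ) θ := by
  have hray : HasDerivAt (fun s : ℝ => c + s • θ) θ t := by
    simpa using ((hasDerivAt_id t).smul_const θ).const_add c
  have hder := hd.hasFDerivAt.comp_hasDerivAt t hray
  have h := (convexOn_ray hF c θ).slope_le_of_hasDerivAt (Set.mem_univ 0) (Set.mem_univ t) ht hder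
  refine lt_of_lt_of_le ?_ h
  rw [slope_def_field]
  simp only [zero_smul, add_zero, hFt, sub_zero]
  exact div_pos (sub_pos.2 hc) ht

/-- A positive function `r` that picks on every ray from `c` the point of the level set `{F = k}` is
smooth, because it agrees locally with the implicit function of `F (c + t • θ) = k`. -/
theorem contDiffAt_radius [CompleteSpace E] (hF : ConvexOn ℝ Set.univ F) (hFs : ContDiff ℝ ∞ F)
    (hc : F c < k) {r : E → ℝ} (hr : ∀ θ, θ ≠ 0 → 0 < r θ ∧ F (c + r θ • θ) = k) (hθ : θ ≠ 0) :
    ContDiffAt ℝ ∞ r θ := by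
  let G : E × ℝ → ℝ := fun q => F (c + q.2 • q.1)
  have hG : ContDiff ℝ ∞ G := by fun_prop
  have hGat : ContDiffAt ℝ ∞ G (θ, r θ) := hG.contDiffAt
  obtain ⟨hrpos, hrk⟩ := hr θ hθ
  have hpos := radial_deriv_pos hF hc hrpos (hFs.differentiable (by simp) _) hrk
  have hinr : fderiv ℝ G (θ, r θ) ∘L .inr ℝ E ℝ
      = .toSpanSingleton ℝ (fderiv ℝ F (c + r θ • θ) θ) := by
    have h1 : HasFDerivAt (fun t : ℝ => (θ, t)) (.inr ℝ E ℝ) (r θ) := hasFDerivAt_prodMk_right _ _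
    have h2 := (hG.differentiable (by simp) (θ, r θ)).hasFDerivAt.comp (r θ) h1
    have hray : HasDerivAt (fun s : ℝ => c + s • θ) θ (r θ) := by
      simpa using ((hasDerivAt_id (r θ)).smul_const θ).const_add c
    have h3 := (hFs.differentiable (by simp) (c + r θ • θ)).hasFDerivAt.comp_hasDerivAt _ hray
    exact h2.unique h3.hasFDerivAt
  have hinv : (fderiv ℝ G (θ, r θ) ∘L .inr ℝ E ℝ).IsInvertible := by
    rw [hinr]
    refine ⟨ContinuousLinearEquiv.unitsEquivAut ℝ (Units.mk0 _ hpos.ne'), ?_⟩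
    ext
    simp
  have hn : (∞ : WithTop ℕ∞) ≠ 0 := by simp
  have hself := hGat.implicitFunction_apply_self hn hinv
  have hsm := hGat.contDiffAt_implicitFunction hn hinv
  have hev := hGat.eventually_apply_implicitFunction hn hinv
  refine hsm.congr_of_eventuallyEq ?_
  have hpos' : ∀ᶠ x in 𝓝 θ, 0 < hGat.implicitFunction hn hinv x :=
    hsm.continuousAt.eventually (lt_mem_nhds (by rw [hself]; exact hrpos))
  filter_upwards [hev, hpos', isOpen_ne.mem_nhds hθ] with x hx hxpos hx0
  exact level_on_ray_unique hF hc (hr x hx0).1 hxpos (hr x hx0).2 (hx.trans hrk)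

end Convex

/-- A level set of a smooth convex function that is crossed by every ray from a point below the level
is diffeomorphic to the sphere, by radial projection. -/
theorem areDiffeomorphic_levelSet_sphere {n : ℕ} {F : EuclideanSpace ℝ (Fin n) → ℝ}
    {c : EuclideanSpace ℝ (Fin n)} {k : ℝ} (hF : ConvexOn ℝ Set.univ F) (hFs : ContDiff ℝ ∞ F)
    (hc : F c < k) (hray : ∀ θ, θ ≠ 0 → ∃ t : ℝ, 0 < t ∧ k < F (c + t • θ)) :
    AreDiffeomorphic {p | F p = k} (Metric.sphere (0 : EuclideanSpace ℝ (Fin n)) 1) := by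
  have hex : ∀ θ, ∃ t : ℝ, θ ≠ 0 → 0 < t ∧ F (c + t • θ) = k := fun θ => by
    by_cases hθ : θ = 0
    · exact ⟨0, fun h => absurd hθ h⟩
    · obtain ⟨t, ht⟩ := exists_level_on_ray hFs.continuous hc (hray θ hθ)
      exact ⟨t, fun _ => ht⟩
  choose r hr using hex
  have hne : ∀ p, F p = k → p - c ≠ 0 := fun p hp h => by
    rw [sub_eq_zero.1 h] at hp
    exact hc.ne hp
  have hsph : ∀ θ ∈ Metric.sphere (0 : EuclideanSpace ℝ (Fin n)) 1, ‖θ‖ = 1 ∧ θ ≠ 0 := by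
    intro θ hθ
    have h1 : ‖θ‖ = 1 := by simpa using hθ
    exact ⟨h1, fun h => by simp [h] at h1⟩
  have hnorm : ∀ p, F p = k → ‖‖p - c‖⁻¹ • (p - c)‖ = 1 := fun p hp => by
    rw [norm_smul, norm_inv, norm_norm, inv_mul_cancel₀ (norm_ne_zero_iff.2 (hne p hp))]
  refine ⟨fun p => ‖p - c‖⁻¹ • (p - c), fun θ => c + r θ • θ, ?_, ?_, ⟨?_, ?_⟩, ?_, ?_⟩
  · intro p hp
    simpa using hnorm p hp
  · intro θ hθ
    exact (hr θ (hsph θ hθ).2).2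
  · intro p hp
    have hp0 := norm_pos_iff.2 (hne p hp)
    have hback : c + ‖p - c‖ • ‖p - c‖⁻¹ • (p - c) = p := by
      rw [smul_smul, mul_inv_cancel₀ hp0.ne', one_smul, add_sub_cancel]
    have hθ : ‖p - c‖⁻¹ • (p - c) ≠ 0 := smul_ne_zero (inv_ne_zero hp0.ne') (hne p hp)
    have heq : r (‖p - c‖⁻¹ • (p - c)) = ‖p - c‖ :=
      level_on_ray_unique hF hc (hr _ hθ).1 hp0 (hr _ hθ).2 (by rw [hback]; exact hp)
    change c + r (‖p - c‖⁻¹ • (p - c)) • ‖p - c‖⁻¹ • (p - c) = p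
    rw [heq, hback]
  · intro θ hθ
    obtain ⟨h1, h0⟩ := hsph θ hθ
    have hrp := (hr θ h0).1
    change ‖c + r θ • θ - c‖⁻¹ • (c + r θ • θ - c) = θ
    rw [add_sub_cancel_left, norm_smul, h1, mul_one, Real.norm_of_nonneg hrp.le, smul_smul,
      inv_mul_cancel₀ hrp.ne', one_smul]
  · refine SmoothOnSubset.of_contDiffOn (U := {c}ᶜ) isOpen_compl_singleton
      (fun p hp => sub_ne_zero.1 (hne p hp)) fun p hp => ContDiffAt.contDiffWithinAt ?_
    have hpc : p - c ≠ 0 := sub_ne_zero.2 hp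
    have hsub : ContDiffAt ℝ ∞ (fun q => q - c) p := by fun_prop
    exact ((hsub.norm ℝ hpc).inv (norm_ne_zero_iff.2 hpc)).smul hsub
  · refine SmoothOnSubset.of_contDiffOn (U := {0}ᶜ) isOpen_compl_singleton
      (fun θ hθ => (hsph θ hθ).2) fun θ hθ => ContDiffAt.contDiffWithinAt ?_
    exact contDiffAt_const.add ((contDiffAt_radius hF hFs hc hr hθ).smul contDiffAt_id)

/-! ### Posynomials in logarithmic coordinates -/

section Posynomial

variable {n : ℕ} {F G : EuclideanSpace ℝ (Fin n) → ℝ}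

/-- Posynomials in logarithmic coordinates: finite sums of terms `b * exp (ℓ u)` with `b ≥ 0` and
`ℓ` linear. For integral `ℓ` these are the Laurent polynomials in `exp (u i)` with nonnegative
coefficients. -/
inductive IsPosynomial : (EuclideanSpace ℝ (Fin n) → ℝ) → Prop
  | monomial (b : ℝ) (hb : 0 ≤ b) (ℓ : EuclideanSpace ℝ (Fin n) →L[ℝ] ℝ) :
      IsPosynomial fun u => b * Real.exp (ℓ u)
  | add {F G : EuclideanSpace ℝ (Fin n) → ℝ} (hF : IsPosynomial F) (hG : IsPosynomial G) :
      IsPosynomial fun u => F u + G u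

namespace IsPosynomial

theorem const {b : ℝ} (hb : 0 ≤ b) : IsPosynomial fun _ : EuclideanSpace ℝ (Fin n) => b := by
  simpa using monomial b hb (0 : EuclideanSpace ℝ (Fin n) →L[ℝ] ℝ)

theorem exp_coord (i : Fin n) :
    IsPosynomial fun u : EuclideanSpace ℝ (Fin n) => Real.exp (u i) := by
  simpa using monomial 1 zero_le_one (EuclideanSpace.proj i : EuclideanSpace ℝ (Fin n) →L[ℝ] ℝ)

theorem exp_neg_coord (i : Fin n) :
    IsPosynomial fun u : EuclideanSpace ℝ (Fin n) => Real.exp (-u i) := by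
  simpa using monomial 1 zero_le_one (-EuclideanSpace.proj i : EuclideanSpace ℝ (Fin n) →L[ℝ] ℝ)

theorem mul (hF : IsPosynomial F) (hG : IsPosynomial G) : IsPosynomial fun u => F u * G u := by
  induction hF with
  | monomial b hb ℓ =>
    induction hG with
    | monomial b' hb' ℓ' =>
      have h := monomial (b * b') (mul_nonneg hb hb') (ℓ + ℓ')
      simpa [Real.exp_add, mul_mul_mul_comm] using h
    | add _ _ h₁ h₂ => simpa only [mul_add] using h₁.add h₂
  | add _ _ h₁ h₂ => simpa only [add_mul] using h₁.add h₂

theorem contDiff (hF : IsPosynomial F) : ContDiff ℝ ∞ F := by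
  induction hF with
  | monomial b hb ℓ => fun_prop
  | add _ _ h₁ h₂ => exact h₁.add h₂

theorem convexOn (hF : IsPosynomial F) : ConvexOn ℝ Set.univ F := by
  induction hF with
  | monomial b hb ℓ => exact (convexOn_exp.comp_linearMap ℓ.toLinearMap).smul hb
  | add _ _ h₁ h₂ => exact h₁.add h₂

end IsPosynomial

/-- The coordinatewise exponential, a diffeomorphism from the Euclidean space onto its open positive
orthant. -/
noncomputable def expMap (u : EuclideanSpace ℝ (Fin n)) : EuclideanSpace ℝ (Fin n) :=
  WithLp.toLp 2 fun i => Real.exp (u i)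

/-- The coordinatewise logarithm, inverse to `expMap` on the open positive orthant. -/
noncomputable def logMap (p : EuclideanSpace ℝ (Fin n)) : EuclideanSpace ℝ (Fin n) :=
  WithLp.toLp 2 fun i => Real.log (p i)

@[simp] theorem expMap_apply (u : EuclideanSpace ℝ (Fin n)) (i : Fin n) :
    expMap u i = Real.exp (u i) := rfl

@[simp] theorem logMap_apply (p : EuclideanSpace ℝ (Fin n)) (i : Fin n) :
    logMap p i = Real.log (p i) := rfl

@[simp] theorem logMap_expMap (u : EuclideanSpace ℝ (Fin n)) : logMap (expMap u) = u := by
  ext i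
  simp

theorem expMap_logMap {p : EuclideanSpace ℝ (Fin n)} (hp : ∀ i, 0 < p i) :
    expMap (logMap p) = p := by
  ext i
  simp [Real.exp_log (hp i)]

theorem contDiff_expMap : ContDiff ℝ ∞ (expMap (n := n)) := by
  rw [contDiff_euclidean]
  intro i
  simp only [expMap_apply]
  fun_prop

theorem contDiffAt_logMap {p : EuclideanSpace ℝ (Fin n)} (hp : ∀ i, 0 < p i) :
    ContDiffAt ℝ ∞ (logMap (n := n)) p := by
  rw [contDiffAt_euclidean]
  intro i
  simp only [logMap_apply]
  exact ContDiffAt.log (by fun_prop) (hp i).ne'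

/-- If a function bounds `p i` and `a / p i` on the positive orthant, then in logarithmic
coordinates it exceeds every value on every ray. -/
theorem exists_lt_on_ray {V : EuclideanSpace ℝ (Fin n) → ℝ} {a : ℝ} (ha : 0 < a)
    (hV : ∀ p : EuclideanSpace ℝ (Fin n), (∀ i, 0 < p i) → ∀ i, p i ≤ V p ∧ a / p i ≤ V p)
    (k : ℝ) (c : EuclideanSpace ℝ (Fin n)) {θ : EuclideanSpace ℝ (Fin n)} (hθ : θ ≠ 0) :
    ∃ t : ℝ, 0 < t ∧ k < V (expMap (c + t • θ)) := by
  obtain ⟨i, hi⟩ : ∃ i, θ i ≠ 0 := by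
    by_contra! h
    exact hθ (by ext i; simpa using h i)
  have key : ∀ u : EuclideanSpace ℝ (Fin n), min 1 a * |u i| ≤ V (expMap u) := by
    intro u
    obtain ⟨h1, h2⟩ := hV (expMap u) (fun j => Real.exp_pos _) i
    rw [expMap_apply] at h1 h2
    rw [div_eq_mul_inv, ← Real.exp_neg] at h2
    rcases le_total 0 (u i) with h | h
    · rw [abs_of_nonneg h]
      have := Real.add_one_le_exp (u i)
      nlinarith [mul_le_mul_of_nonneg_right (min_le_left 1 a) h]
    · rw [abs_of_nonpos h]
      have := Real.add_one_le_exp (-u i)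
      have h3 := mul_le_mul_of_nonneg_right (min_le_right 1 a) (neg_nonneg.2 h)
      nlinarith
  have hm : 0 < min 1 a := lt_min one_pos ha
  have hi' : 0 < |θ i| := abs_pos.2 hi
  refine ⟨(|k| / min 1 a + |c i| + 1) / |θ i|, by positivity, lt_of_lt_of_le ?_ (key _)⟩
  set t := (|k| / min 1 a + |c i| + 1) / |θ i| with ht
  have ht0 : 0 < t := by positivity
  have htθ : |t * θ i| = |k| / min 1 a + |c i| + 1 := by
    rw [abs_mul, abs_of_pos ht0, ht, div_mul_cancel₀ _ hi'.ne']
  have htri : |t * θ i| ≤ |c i + t * θ i| + |c i| := by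
    simpa using abs_sub (c i + t * θ i) (c i)
  have hlt : |k| / min 1 a < |c i + t * θ i| := by linarith
  rw [div_lt_iff₀ hm] at hlt
  simp only [PiLp.add_apply, PiLp.smul_apply, smul_eq_mul]
  linarith [le_abs_self k]

theorem areDiffeomorphic_orthant_levelSet_sphere {V : EuclideanSpace ℝ (Fin n) → ℝ} {a k : ℝ}
    (ha : 0 < a) (hpos : IsPosynomial fun u => V (expMap u))
    (hV : ∀ p : EuclideanSpace ℝ (Fin n), (∀ i, 0 < p i) → ∀ i, p i ≤ V p ∧ a / p i ≤ V p)
    {c : EuclideanSpace ℝ (Fin n)} (hc : ∀ i, 0 < c i) (hk : V c < k) :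
    AreDiffeomorphic {p | (∀ i, 0 < p i) ∧ V p = k}
      (Metric.sphere (0 : EuclideanSpace ℝ (Fin n)) 1) := by
  refine AreDiffeomorphic.trans (Y := {u | V (expMap u) = k}) ?_
    (areDiffeomorphic_levelSet_sphere (c := logMap c) hpos.convexOn hpos.contDiff
      (by rwa [expMap_logMap hc]) fun θ hθ => exists_lt_on_ray ha hV k (logMap c) hθ)
  refine ⟨logMap, expMap, ?_, ?_, ⟨?_, ?_⟩, ?_, ?_⟩
  · rintro p ⟨hp, hpk⟩
    change V (expMap (logMap p)) = k
    rwa [expMap_logMap hp]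
  · exact fun u hu => ⟨fun i => Real.exp_pos _, hu⟩
  · exact fun p hp => expMap_logMap hp.1
  · exact fun u _ => logMap_expMap u
  · refine SmoothOnSubset.of_contDiffOn (U := {p | ∀ i, 0 < p i}) ?_ (fun p hp => hp.1)
      fun p hp => (contDiffAt_logMap hp).contDiffWithinAt
    simp only [Set.ofPred_forall]
    exact isOpen_iInter_of_finite fun i => isOpen_lt continuous_const (by fun_prop)
  · exact SmoothOnSubset.of_contDiffOn isOpen_univ (Set.subset_univ _) contDiff_expMap.contDiffOn

end Posynomial

/-! ### The two first integrals -/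

section FirstIntegrals

variable {a : ℝ}

theorem mem_octant_iff {p : EuclideanSpace ℝ (Fin 3)} : p ∈ octant ↔ ∀ i, 0 < p i := by
  simp [octant, Fin.forall_fin_succ]

theorem fixedPoint_pos (a : ℝ) (i : Fin 3) : 0 < fixedPoint a i := by
  have h : 0 < xc a := by unfold xc; positivity
  fin_cases i <;> simpa [fixedPoint] using h

theorem isPosynomial_V₁ (ha : 0 < a) : IsPosynomial fun u => V₁ a (expMap u) := by
  have h : (fun u : EuclideanSpace ℝ (Fin 3) => V₁ a (expMap u)) = fun u =>
      (1 + Real.exp (-u 0)) * (1 + Real.exp (-u 1)) * (1 + Real.exp (-u 2)) *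
        (a + Real.exp (u 0) + Real.exp (u 1) + Real.exp (u 2)) := by
    funext u
    simp only [V₁, expMap_apply, Real.exp_neg]
    field_simp
  rw [h]
  have hinv (i : Fin 3) := (IsPosynomial.const zero_le_one).add (IsPosynomial.exp_neg_coord i)
  exact (((hinv 0).mul (hinv 1)).mul (hinv 2)).mul
    ((((IsPosynomial.const ha.le).add (.exp_coord 0)).add (.exp_coord 1)).add (.exp_coord 2))

theorem isPosynomial_V₂ (ha : 0 < a) : IsPosynomial fun u => V₂ a (expMap u) := by
  have h : (fun u : EuclideanSpace ℝ (Fin 3) => V₂ a (expMap u)) = fun u =>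
      (1 + Real.exp (u 1) + Real.exp (u 2)) * (1 + Real.exp (u 0) + Real.exp (u 1)) *
        (a + Real.exp (u 0) + Real.exp (u 1) + Real.exp (u 2) + Real.exp (u 0) * Real.exp (u 2)) *
        (Real.exp (-u 0) * Real.exp (-u 1) * Real.exp (-u 2)) := by
    funext u
    simp only [V₂, expMap_apply, Real.exp_neg]
    field_simp
  rw [h]
  have hlin (i j : Fin 3) :=
    ((IsPosynomial.const zero_le_one).add (IsPosynomial.exp_coord i)).add (.exp_coord j)
  exact (((hlin 1 2).mul (hlin 0 1)).mul
    (((((IsPosynomial.const ha.le).add (.exp_coord 0)).add (.exp_coord 1)).add (.exp_coord 2)).add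
      ((IsPosynomial.exp_coord 0).mul (.exp_coord 2)))).mul
    (((IsPosynomial.exp_neg_coord 0).mul (.exp_neg_coord 1)).mul (.exp_neg_coord 2))

theorem coord_le_V₁ (ha : 0 < a) (p : EuclideanSpace ℝ (Fin 3)) (hp : ∀ i, 0 < p i)
    (i : Fin 3) :
    p i ≤ V₁ a p ∧ a / p i ≤ V₁ a p := by
  have h0 := hp 0
  have h1 := hp 1
  have h2 := hp 2
  unfold V₁
  -- After expansion, `p i` and `a / p i` are among the monomials, all of which are positive.
  constructor <;> fin_cases i <;> simp only [Fin.zero_eta, Fin.mk_one, Fin.reduceFinMk] <;>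
    rw [← sub_nonneg] <;> field_simp <;> ring_nf <;> positivity

theorem coord_le_V₂ (ha : 0 < a) (p : EuclideanSpace ℝ (Fin 3)) (hp : ∀ i, 0 < p i)
    (i : Fin 3) :
    p i ≤ V₂ a p ∧ a / p i ≤ V₂ a p := by
  have h0 := hp 0
  have h1 := hp 1
  have h2 := hp 2
  unfold V₂
  -- After expansion, `p i` and `a / p i` are among the monomials, all of which are positive.
  constructor <;> fin_cases i <;> simp only [Fin.zero_eta, Fin.mk_one, Fin.reduceFinMk] <;>
    rw [← sub_nonneg] <;> field_simp <;> ring_nf <;> positivity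

end FirstIntegrals

end Lyness

theorem proposition7 (a : ℝ) (ha : 0 < a) :
    (∀ k : ℝ, Lyness.kc a < k → Lyness.AreDiffeomorphic (Lyness.L a k) Lyness.unitSphere) ∧
    (∀ h : ℝ, Lyness.hc a < h → Lyness.AreDiffeomorphic (Lyness.M a h) Lyness.unitSphere) := by
  constructor
  · intro k hk
    simpa only [Lyness.L, Lyness.unitSphere, Lyness.mem_octant_iff] using
      Lyness.areDiffeomorphic_orthant_levelSet_sphere ha (Lyness.isPosynomial_V₁ ha)
        (Lyness.coord_le_V₁ ha) (Lyness.fixedPoint_pos a) hk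
  · intro h hh
    simpa only [Lyness.M, Lyness.unitSphere, Lyness.mem_octant_iff] using
      Lyness.areDiffeomorphic_orthant_levelSet_sphere ha (Lyness.isPosynomial_V₂ ha)
        (Lyness.coord_le_V₂ ha) (Lyness.fixedPoint_pos a) hh
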